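/- A frequency is a strictly increasing sequence $\lambda=(\lambda_n)_{n\ge 1}$ of non-negative real numbers tending to $+\infty$. It satisfies Bohr's condition $(BC)$ if $$\exists\, l>0\ \ \forall\,\delta>0\ \ \exists\, c>0\ \ \forall\, n\ge 1:\quad \lambda_{n+1}-\lambda_n\ \ge\ c\,e^{-(l+\delta)\lambda_n}.$$ Let $\mathcal D_\infty^{ext}(\lambda)$ be the space of all Dirichlet series $D=\sum_{n\ge1} a_n e^{-\lambda_n s}$ with complex coefficients which converge at some point of $\mathbb C$ and whose limit function has a holomorphic and bounded extension $f$ to the half plane $[\mathrm{Re}>0]$; put $\|D\|_\infty:=\sup_{\mathrm{Re}\, s>0}|f(s)|$, where $f$ is this (unique) extension. Let $\lambda$ be a frequency satisfying $(BC)$. Then there is a constant $C=C(\lambda)>0$ such that for all $D=\sum a_n e^{-\lambda_n s}\in\mathcal D_\infty^{ext}(\lambda)$ and all $N\in\mathbb N$ with $N\ge 2$ $$\sup_{\mathrm{Re}\, s>0}\Bigl|\sum_{n=1}^{N} a_n e^{-\lambda_n s}\Bigr|\ \le\ C\,\lambda_N\,\|D\|_\infty .$$ In particular, for $\lambda=(\log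 n)$ there is a constant $C>0$ such that for all ordinary Dirichlet series $D=\sum a_n n^{-s}\in\mathcal D_\infty^{ext}((\log n))$ and all $N\ge 2$ $$\sup_{\mathrm{Re}\, s>0}\Bigl|\sum_{n=1}^{N} a_n n^{-s}\Bigr|\ \le\ C\,\log (N)\,\|D\|_\infty .$$ -/

import Mathlib

open Filter Topology
open scoped ENNReal

namespace GeneralDirichlet

/-- A frequency `λ = (λ_n)_{n ≥ 1}`: a strictly increasing non-negative real sequence tending
to `+∞`. Sequences are indexed by `n = 1, 2, 3, …`; the value at `0` is never used. -/
structure IsFrequency (lam : ℕ → ℝ) : Prop where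
  nonneg : ∀ n, 1 ≤ n → 0 ≤ lam n
  strictMonoOn : StrictMonoOn lam (Set.Ici 1)
  tendsto : Tendsto lam atTop atTop

/-- Bohr's condition (BC). -/
def BohrCondition (lam : ℕ → ℝ) : Prop :=
  ∃ l : ℝ, 0 < l ∧ ∀ δ : ℝ, 0 < δ → ∃ C : ℝ, 0 < C ∧ ∀ n : ℕ, 1 ≤ n →
    C * Real.exp (-(l + δ) * lam n) ≤ lam (n + 1) - lam n

/-- The open half plane `[Re > σ]`. -/
def halfPlane (σ : ℝ) : Set ℂ := {s : ℂ | σ < s.re}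

/-- The partial sum `∑_{n=1}^N a_n e^{-λ_n s}` of the formal series `D = ∑ a_n e^{-λ_n s}`. -/
noncomputable def partialSum (lam : ℕ → ℝ) (a : ℕ → ℂ) (N : ℕ) (s : ℂ) : ℂ :=
  ∑ n ∈ Finset.Icc 1 N, a n * Complex.exp (-(lam n : ℂ) * s)

/-- The series `∑ a_n e^{-λ_n s}` converges at the point `s`. -/
def ConvergesAt (lam : ℕ → ℝ) (a : ℕ → ℂ) (s : ℂ) : Prop :=
  ∃ z : ℂ, Tendsto (fun N => partialSum lam a N s) atTop (𝓝 z)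

/-- `f` is a holomorphic and bounded extension to `[Re > 0]` of the limit function of
`∑ a_n e^{-λ_n s}`: on every open half plane of convergence, `f` is the limit of the series at the
points with positive real part. -/
structure IsBoundedExtension (lam : ℕ → ℝ) (a : ℕ → ℂ) (f : ℂ → ℂ) : Prop where
  holomorphic : DifferentiableOn ℂ f (halfPlane 0)
  bounded : ∃ M : ℝ, ∀ s ∈ halfPlane 0, ‖f s‖ ≤ M
  extends_limit : ∀ σ : ℝ, (∀ s ∈ halfPlane σ, ConvergesAt lam a s) →
    ∀ s ∈ halfPlane σ ∩ halfPlane 0, Tendsto (fun N => partialSum lam a N s) atTop (𝓝 (f s))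

/-- The space of all somewhere convergent `λ`-Dirichlet series (given by their coefficients)
which allow a holomorphic and bounded extension to `[Re > 0]`. -/
def DInftyExt (lam : ℕ → ℝ) : Set (ℕ → ℂ) :=
  {a | (∃ s : ℂ, ConvergesAt lam a s) ∧ ∃ f : ℂ → ℂ, IsBoundedExtension lam a f}

/-- `sup_{[Re > 0]} |f(s)|` as an element of `[0, ∞]`. For `D` in `DInftyExt lam` with extension
`f` this is the (finite) norm `‖D‖_∞`. -/
noncomputable def supNorm (f : ℂ → ℂ) : ℝ≥0∞ := ⨆ s ∈ halfPlane 0, ‖f s‖ₑ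

end GeneralDirichlet

namespace GeneralDirichlet

open MeasureTheory Set

/-! Partial sums are produced by convolving `f` along vertical lines with `trapKernel M B`, where `M
= λ_N` and `M < B ≤ λ_{N+1}`. Its Fourier transform is `kappa * (B - M)` at `λ_1, …, λ_N` and
vanishes at all later frequencies, so the convolution is `kappa * (B - M)` times the `N`-th partial
sum wherever the series converges absolutely (`vertical_integral_trapKernel_eq`). Both sides are
holomorphic on `[Re > 0]`, so the identity persists there. The `L¹` norm of the kernel is at most `2
(B - M) (3 + log (B / (B - M)))` (`integral_abs_trapKernel_le`). The factor `B - M` cancels, and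
Bohr's condition makes the logarithm `O(λ_N)` (`exists_log_le`). -/

/-! ### The trapezoid kernel and its Fourier transform -/

/-- The constant `∫ (1 - cos t) / t² dt`. -/
noncomputable def kappa : ℝ := ∫ t : ℝ, (1 - Real.cos t) / t ^ 2

lemma integrable_one_sub_cos_div_sq : Integrable (fun t : ℝ => (1 - Real.cos t) / t ^ 2) := by
  refine Integrable.mono' (integrable_inv_one_add_sq.const_mul 4)
    (by fun_prop : Measurable _).aestronglyMeasurable (Eventually.of_forall fun t => ?_)
  have h1 : 0 ≤ 1 - Real.cos t := by linarith [Real.cos_le_one t]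
  rw [Real.norm_of_nonneg (by positivity)]
  rcases eq_or_ne t 0 with rfl | ht
  · simp
  have ht2 : 0 < t ^ 2 := by positivity
  rw [div_le_iff₀ ht2, mul_assoc, inv_mul_eq_div, ← mul_div_assoc, le_div_iff₀ (by positivity)]
  -- Combining `1 - cos t ≤ t² / 2` with `1 - cos t ≤ 2` gives `(1 - cos t) (1 + t²) ≤ 5 t² / 2`.
  have h2 := Real.one_sub_sq_div_two_le_cos (x := t)
  have h3 := Real.neg_one_le_cos t
  nlinarith [mul_nonneg ht2.le h1]

lemma kappa_pos : 0 < kappa := by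
  have h0 : ∀ t : ℝ, 0 ≤ (1 - Real.cos t) / t ^ 2 := fun t =>
    div_nonneg (by linarith [Real.cos_le_one t]) (sq_nonneg t)
  rw [kappa, integral_pos_iff_support_of_nonneg h0 integrable_one_sub_cos_div_sq]
  refine lt_of_lt_of_le (b := volume (Ioo (0 : ℝ) 1)) (by simp) (measure_mono fun t ht => ?_)
  have hc : Real.cos t < 1 := by
    have := Real.cos_lt_cos_of_nonneg_of_le_pi le_rfl (by linarith [Real.pi_gt_three, ht.2]) ht.1
    simpa using this
  exact (div_pos (by linarith) (pow_pos ht.1 2)).ne'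

lemma one_sub_cos_mul_div_sq (a t : ℝ) :
    (1 - Real.cos (a * t)) / t ^ 2 = a ^ 2 * ((1 - Real.cos (a * t)) / (a * t) ^ 2) := by
  rcases eq_or_ne a 0 with rfl | ha
  · simp
  rcases eq_or_ne t 0 with rfl | ht
  · simp
  field_simp

lemma integrable_one_sub_cos_mul_div_sq (a : ℝ) :
    Integrable (fun t : ℝ => (1 - Real.cos (a * t)) / t ^ 2) := by
  simp_rw [one_sub_cos_mul_div_sq a]
  rcases eq_or_ne a 0 with rfl | ha
  · simp
  exact (integrable_one_sub_cos_div_sq.comp_mul_left' ha).const_mul _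

lemma integral_one_sub_cos_mul_div_sq (a : ℝ) :
    ∫ t : ℝ, (1 - Real.cos (a * t)) / t ^ 2 = |a| * kappa := by
  simp_rw [one_sub_cos_mul_div_sq a]
  rw [integral_const_mul, Measure.integral_comp_mul_left (fun t => (1 - Real.cos t) / t ^ 2) a,
    ← kappa, smul_eq_mul, ← mul_assoc]
  congr 1
  rcases eq_or_ne a 0 with rfl | ha
  · simp
  rw [abs_inv, ← sq_abs]
  field_simp

/-- A kernel of de la Vallée Poussin type, whose cosine transform is a multiple of the trapezoid
function which equals `1` on `[-M, M]` and `0` outside `[-B, B]`. -/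
noncomputable def trapKernel (M B t : ℝ) : ℝ := (Real.cos (M * t) - Real.cos (B * t)) / t ^ 2

lemma trapKernel_neg (M B t : ℝ) : trapKernel M B (-t) = trapKernel M B t := by
  simp [trapKernel]

lemma integrable_trapKernel (M B : ℝ) : Integrable (trapKernel M B) := by
  refine ((integrable_one_sub_cos_mul_div_sq B).sub
    (integrable_one_sub_cos_mul_div_sq M)).congr (Eventually.of_forall fun t => ?_)
  simp only [Pi.sub_apply, trapKernel]
  ring

lemma integral_trapKernel_mul_cos (M B l : ℝ) :
    ∫ t, trapKernel M B t * Real.cos (l * t) =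
      kappa / 2 * (|B - l| + |B + l| - |M - l| - |M + l|) := by
  -- Product-to-sum; each cosine is paired with a `1` because `cos (a t) / t²` alone is not
  -- integrable at `0`.
  have h : ∀ t, trapKernel M B t * Real.cos (l * t) =
      1 / 2 * ((((1 - Real.cos ((B - l) * t)) / t ^ 2 + (1 - Real.cos ((B + l) * t)) / t ^ 2) -
        (1 - Real.cos ((M - l) * t)) / t ^ 2) - (1 - Real.cos ((M + l) * t)) / t ^ 2) := by
    intro t
    simp only [trapKernel, sub_mul, add_mul, Real.cos_sub, Real.cos_add]
    ring
  simp_rw [h]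
  have I := integrable_one_sub_cos_mul_div_sq
  have I₂ : Integrable fun t : ℝ =>
      (1 - Real.cos ((B - l) * t)) / t ^ 2 + (1 - Real.cos ((B + l) * t)) / t ^ 2 :=
    (I _).add (I _)
  have I₃ : Integrable fun t : ℝ => ((1 - Real.cos ((B - l) * t)) / t ^ 2 +
      (1 - Real.cos ((B + l) * t)) / t ^ 2) - (1 - Real.cos ((M - l) * t)) / t ^ 2 :=
    I₂.sub (I _)
  rw [integral_const_mul, integral_sub I₃ (I _), integral_sub I₂ (I _), integral_add (I _) (I _)]
  simp_rw [integral_one_sub_cos_mul_div_sq]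
  ring

lemma integral_trapKernel_mul_sin (M B l : ℝ) :
    ∫ t, trapKernel M B t * Real.sin (l * t) = 0 := by
  have h := integral_neg_eq_self (fun t => trapKernel M B t * Real.sin (l * t)) volume
  simp only [trapKernel_neg, mul_neg, Real.sin_neg, integral_neg] at h
  linarith

lemma integrable_trapKernel_mul_exp (M B l : ℝ) :
    Integrable (fun t : ℝ => (trapKernel M B t : ℂ) * Complex.exp (-(l : ℂ) * (t * Complex.I))) := by
  refine (integrable_trapKernel M B).ofReal.mul_bdd (c := 1)
    (by fun_prop : Continuous _).aestronglyMeasurable (Eventually.of_forall fun t => ?_)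
  rw [Complex.norm_exp]
  simp

lemma integral_trapKernel_mul_exp (M B l : ℝ) :
    ∫ t : ℝ, (trapKernel M B t : ℂ) * Complex.exp (-(l : ℂ) * (t * Complex.I)) =
      ((kappa / 2 * (|B - l| + |B + l| - |M - l| - |M + l|) : ℝ) : ℂ) := by
  have hb : ∀ g : ℝ → ℝ, Continuous g → (∀ t, |g t| ≤ 1) →
      Integrable fun t => trapKernel M B t * g t := fun g hg h1 =>
    (integrable_trapKernel M B).mul_bdd (c := 1) hg.aestronglyMeasurable
      (Eventually.of_forall h1)
  have hc := hb (fun t => Real.cos (l * t)) (by fun_prop) fun t => Real.abs_cos_le_one _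
  have hs := hb (fun t => Real.sin (l * t)) (by fun_prop) fun t => Real.abs_sin_le_one _
  have h : ∀ t : ℝ, (trapKernel M B t : ℂ) * Complex.exp (-(l : ℂ) * (t * Complex.I)) =
      ((trapKernel M B t * Real.cos (l * t) : ℝ) : ℂ) -
        ((trapKernel M B t * Real.sin (l * t) : ℝ) : ℂ) * Complex.I := by
    intro t
    rw [show -(l : ℂ) * (t * Complex.I) = ((-(l * t) : ℝ) : ℂ) * Complex.I by push_cast; ring,
      Complex.exp_mul_I, ← Complex.ofReal_cos, ← Complex.ofReal_sin, Real.cos_neg, Real.sin_neg]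
    push_cast
    ring
  simp_rw [h]
  rw [integral_sub hc.ofReal (hs.ofReal.mul_const _), integral_mul_const, integral_complex_ofReal,
    integral_complex_ofReal, integral_trapKernel_mul_cos, integral_trapKernel_mul_sin]
  simp

lemma integral_trapKernel_mul_exp_of_le {M B l : ℝ} (hl : 0 ≤ l) (hlM : l ≤ M) (hMB : M ≤ B) :
    ∫ t : ℝ, (trapKernel M B t : ℂ) * Complex.exp (-(l : ℂ) * (t * Complex.I)) =
      ((kappa * (B - M) : ℝ) : ℂ) := by
  rw [integral_trapKernel_mul_exp, abs_of_nonneg (by linarith), abs_of_nonneg (by linarith),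
    abs_of_nonneg (by linarith), abs_of_nonneg (by linarith)]
  congr 1
  ring

lemma integral_trapKernel_mul_exp_of_ge {M B l : ℝ} (hM : 0 ≤ M) (hMB : M ≤ B) (hBl : B ≤ l) :
    ∫ t : ℝ, (trapKernel M B t : ℂ) * Complex.exp (-(l : ℂ) * (t * Complex.I)) = 0 := by
  rw [integral_trapKernel_mul_exp, abs_of_nonpos (by linarith), abs_of_nonneg (by linarith),
    abs_of_nonpos (by linarith), abs_of_nonneg (by linarith), Complex.ofReal_eq_zero]
  ring

/-! ### The `L¹` norm of the kernel -/

lemma abs_trapKernel_le_two_div {M B t : ℝ} : |trapKernel M B t| ≤ 2 / t ^ 2 := by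
  rw [trapKernel, abs_div, abs_of_nonneg (sq_nonneg t)]
  gcongr
  rw [abs_le]
  constructor <;> linarith [Real.cos_le_one (M * t), Real.cos_le_one (B * t),
    Real.neg_one_le_cos (M * t), Real.neg_one_le_cos (B * t)]

lemma abs_cos_sub_cos_le {M B t : ℝ} (hMB : M ≤ B) (ht : 0 < t) :
    |Real.cos (M * t) - Real.cos (B * t)| ≤ 2 * |Real.sin ((M * t + B * t) / 2)| *
      ((B - M) * t / 2) := by
  rw [Real.cos_sub_cos, abs_mul, abs_mul, abs_neg, abs_two]
  gcongr
  refine (Real.abs_sin_le_abs).trans_eq ?_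
  rw [show (M * t - B * t) / 2 = -((B - M) * t / 2) by ring, abs_neg, abs_of_nonneg]
  have := sub_nonneg.2 hMB
  positivity

lemma abs_trapKernel_le_div {M B t : ℝ} (hMB : M ≤ B) (ht : 0 < t) :
    |trapKernel M B t| ≤ (B - M) * t⁻¹ := by
  rw [trapKernel, abs_div, abs_of_nonneg (sq_nonneg t), div_le_iff₀ (by positivity)]
  refine (abs_cos_sub_cos_le hMB ht).trans ?_
  have h1 := Real.abs_sin_le_one ((M * t + B * t) / 2)
  have h2 : 0 ≤ (B - M) * t := mul_nonneg (sub_nonneg.2 hMB) ht.le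
  have h3 : (B - M) * t⁻¹ * t ^ 2 = (B - M) * t := by field_simp
  rw [h3]
  nlinarith

lemma abs_trapKernel_le {M B t : ℝ} (hM : 0 ≤ M) (hMB : M ≤ B) (ht : 0 < t) :
    |trapKernel M B t| ≤ (B - M) * B := by
  rw [trapKernel, abs_div, abs_of_nonneg (sq_nonneg t), div_le_iff₀ (by positivity)]
  refine (abs_cos_sub_cos_le hMB ht).trans ?_
  have h2 : 0 ≤ (B - M) * t := mul_nonneg (sub_nonneg.2 hMB) ht.le
  have h1 : |Real.sin ((M * t + B * t) / 2)| ≤ B * t := by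
    refine (Real.abs_sin_le_abs).trans ?_
    have : 0 ≤ B := hM.trans hMB
    rw [abs_of_nonneg (by positivity)]
    nlinarith
  nlinarith

/-- The half line is cut at `1 / B` and `1 / (B - M)`, with the bounds `(B - M) B`, `(B - M) / t`
and `2 / t²` on the three pieces. Only the middle piece yields a logarithm. -/
lemma integral_abs_trapKernel_le {M B : ℝ} (hM : 0 ≤ M) (hMB : M < B) :
    ∫ t, |trapKernel M B t| ≤ 2 * (B - M) * (3 + Real.log (B / (B - M))) := by
  have hB : 0 < B := hM.trans_lt hMB
  have hd : 0 < B - M := sub_pos.2 hMB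
  have hpq : B⁻¹ ≤ (B - M)⁻¹ := inv_anti₀ hd (by linarith)
  have hp : 0 < B⁻¹ := inv_pos.2 hB
  have hI := (integrable_trapKernel M B).abs
  have heven : ∫ t, |trapKernel M B t| = 2 * ∫ t in Ioi (0 : ℝ), |trapKernel M B t| := by
    rw [← integral_comp_abs (f := fun t => |trapKernel M B t|)]
    refine integral_congr_ae (Eventually.of_forall fun t => ?_)
    rcases abs_choice t with h | h <;> simp [h, trapKernel_neg]
  have hsplit : ∫ t in Ioi (0 : ℝ), |trapKernel M B t| = (∫ t in Ioc 0 B⁻¹, |trapKernel M B t|) +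
      ((∫ t in Ioc B⁻¹ (B - M)⁻¹, |trapKernel M B t|) +
        ∫ t in Ioi (B - M)⁻¹, |trapKernel M B t|) := by
    rw [← setIntegral_union Ioc_disjoint_Ioi_same measurableSet_Ioi hI.integrableOn hI.integrableOn,
      Ioc_union_Ioi_eq_Ioi hpq,
      ← setIntegral_union Ioc_disjoint_Ioi_same measurableSet_Ioi hI.integrableOn hI.integrableOn,
      Ioc_union_Ioi_eq_Ioi hp.le]
  have h1 : ∫ t in Ioc 0 B⁻¹, |trapKernel M B t| ≤ B - M := by
    calc ∫ t in Ioc 0 B⁻¹, |trapKernel M B t| ≤ ∫ t in Ioc 0 B⁻¹, (B - M) * B :=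
          setIntegral_mono_on hI.integrableOn (integrableOn_const (by simp)) measurableSet_Ioc
            fun t ht => abs_trapKernel_le hM hMB.le ht.1
      _ = B - M := by
          simp [hp.le]
          field_simp
  have h2 : ∫ t in Ioc B⁻¹ (B - M)⁻¹, |trapKernel M B t| ≤ (B - M) * Real.log (B / (B - M)) := by
    have hint : IntervalIntegrable (fun t : ℝ => (B - M) * t⁻¹) volume B⁻¹ (B - M)⁻¹ :=
      (intervalIntegral.intervalIntegrable_inv (fun x hx => by
        rw [uIcc_of_le hpq] at hx
        exact (hp.trans_le hx.1).ne') continuousOn_id).const_mul _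
    calc ∫ t in Ioc B⁻¹ (B - M)⁻¹, |trapKernel M B t|
        ≤ ∫ t in Ioc B⁻¹ (B - M)⁻¹, (B - M) * t⁻¹ :=
          setIntegral_mono_on hI.integrableOn
            ((intervalIntegrable_iff_integrableOn_Ioc_of_le hpq).1 hint) measurableSet_Ioc
            fun t ht => abs_trapKernel_le_div hMB.le (hp.trans ht.1)
      _ = (B - M) * Real.log (B / (B - M)) := by
          rw [← intervalIntegral.integral_of_le hpq, intervalIntegral.integral_const_mul,
            integral_inv_of_pos hp (inv_pos.2 hd)]
          congr 2
          field_simp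
  have h3 : ∫ t in Ioi (B - M)⁻¹, |trapKernel M B t| ≤ 2 * (B - M) := by
    have hq : 0 < (B - M)⁻¹ := inv_pos.2 hd
    calc ∫ t in Ioi (B - M)⁻¹, |trapKernel M B t|
        ≤ ∫ t in Ioi (B - M)⁻¹, 2 * t ^ (-2 : ℝ) := by
          refine setIntegral_mono_on hI.integrableOn
            ((integrableOn_Ioi_rpow_of_lt (by norm_num) hq).const_mul 2) measurableSet_Ioi
            fun t ht => ?_
          rw [Real.rpow_neg (hq.trans ht).le, Real.rpow_two, ← div_eq_mul_inv]
          exact abs_trapKernel_le_two_div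
      _ = 2 * (B - M) := by
          rw [integral_const_mul, integral_Ioi_rpow_of_lt (by norm_num) hq]
          norm_num
          rw [Real.rpow_neg_one, inv_inv]
  rw [heven, hsplit]
  nlinarith

/-! ### Convolution along vertical lines -/

lemma isOpen_halfPlane (σ : ℝ) : IsOpen (halfPlane σ) :=
  isOpen_lt continuous_const Complex.continuous_re

lemma add_mul_I_mem_halfPlane {σ : ℝ} {z : ℂ} (hz : z ∈ halfPlane σ) (t : ℝ) :
    z + t * Complex.I ∈ halfPlane σ := by
  simpa [halfPlane] using hz

section VerticalConvolution

variable {f : ℂ → ℂ} {k : ℝ → ℝ} {A : ℝ}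

lemma continuous_vertical (hf : DifferentiableOn ℂ f (halfPlane 0)) {z : ℂ}
    (hz : z ∈ halfPlane 0) : Continuous fun t : ℝ => f (z + t * Complex.I) :=
  hf.continuousOn.comp_continuous (by fun_prop) fun t => add_mul_I_mem_halfPlane hz t

lemma integrable_vertical (hf : DifferentiableOn ℂ f (halfPlane 0))
    (hA : ∀ s ∈ halfPlane 0, ‖f s‖ ≤ A) (hk : Integrable k) {z : ℂ} (hz : z ∈ halfPlane 0) :
    Integrable fun t : ℝ => (k t : ℂ) * f (z + t * Complex.I) :=
  hk.ofReal.mul_bdd (c := A) (continuous_vertical hf hz).aestronglyMeasurable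
    (Eventually.of_forall fun t => hA _ (add_mul_I_mem_halfPlane hz t))

lemma norm_deriv_le_of_bounded (hf : DifferentiableOn ℂ f (halfPlane 0))
    (hA : ∀ s ∈ halfPlane 0, ‖f s‖ ≤ A) {r : ℝ} (hr : 0 < r) {w : ℂ} (hw : r < w.re) :
    ‖deriv f w‖ ≤ A / r := by
  have hsub : Metric.closedBall w r ⊆ halfPlane 0 := by
    intro v hv
    have h := (Complex.abs_re_le_norm (v - w)).trans (mem_closedBall_iff_norm.1 hv)
    rw [Complex.sub_re, abs_le] at h
    show 0 < v.re
    linarith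
  refine Complex.norm_deriv_le_of_forall_mem_sphere_norm_le hr
    (DifferentiableOn.diffContOnCl ?_) fun v hv => hA v (hsub (Metric.sphere_subset_closedBall hv))
  rw [closure_ball w hr.ne']
  exact hf.mono hsub

/-- Differentiation under the integral sign: on `[Re > Re z / 2]` Cauchy's estimate bounds `deriv f`
uniformly, and `k` is integrable. -/
lemma differentiableOn_vertical_integral (hf : DifferentiableOn ℂ f (halfPlane 0))
    (hA : ∀ s ∈ halfPlane 0, ‖f s‖ ≤ A) (hk : Integrable k) :
    DifferentiableOn ℂ (fun z => ∫ t : ℝ, (k t : ℂ) * f (z + t * Complex.I)) (halfPlane 0) := by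
  intro z hz
  set r : ℝ := z.re / 2 with hr
  have hz' : 0 < z.re := hz
  have hr0 : 0 < r := by positivity
  have hmem : halfPlane r ∈ 𝓝 z := (isOpen_halfPlane r).mem_nhds (by
    show r < z.re
    linarith)
  have hsub : halfPlane r ⊆ halfPlane 0 := fun w hw => hr0.trans hw
  refine (hasDerivAt_integral_of_dominated_loc_of_deriv_le (𝕜 := ℂ) (s := halfPlane r)
    (F' := fun w t => (k t : ℂ) * deriv f (w + t * Complex.I)) (bound := fun t => |k t| * (A / r))
    hmem ?_ (integrable_vertical hf hA hk hz) ?_ ?_ (hk.abs.mul_const _)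
    ?_).2.differentiableAt.differentiableWithinAt
  · filter_upwards [hmem] with w hw
    exact (integrable_vertical hf hA hk (hsub hw)).aestronglyMeasurable
  · exact hk.ofReal.aestronglyMeasurable.mul
      ((measurable_deriv f).comp (by fun_prop)).aestronglyMeasurable
  · refine Eventually.of_forall fun t w hw => ?_
    rw [norm_mul, Complex.norm_real, Real.norm_eq_abs]
    gcongr
    exact norm_deriv_le_of_bounded hf hA hr0 (add_mul_I_mem_halfPlane hw t)
  · refine Eventually.of_forall fun t w hw => ?_
    have h := (hf.differentiableAt ((isOpen_halfPlane 0).mem_nhds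
      (add_mul_I_mem_halfPlane (hsub hw) t))).hasDerivAt
    exact (h.comp_add_const w (t * Complex.I)).const_mul _

lemma norm_vertical_integral_le (hA : ∀ s ∈ halfPlane 0, ‖f s‖ ≤ A) (hk : Integrable k)
    {z : ℂ} (hz : z ∈ halfPlane 0) :
    ‖∫ t : ℝ, (k t : ℂ) * f (z + t * Complex.I)‖ ≤ (∫ t, |k t|) * A := by
  rw [← integral_mul_const]
  refine norm_integral_le_of_norm_le (hk.abs.mul_const A) (Eventually.of_forall fun t => ?_)
  rw [norm_mul, Complex.norm_real, Real.norm_eq_abs]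
  gcongr
  exact hA _ (add_mul_I_mem_halfPlane hz t)

end VerticalConvolution

/-! ### Absolute convergence from Bohr's condition -/

lemma norm_term (lam : ℕ → ℝ) (a : ℕ → ℂ) (n : ℕ) (s : ℂ) :
    ‖a n * Complex.exp (-(lam n : ℂ) * s)‖ = ‖a n‖ * Real.exp (-lam n * s.re) := by
  rw [norm_mul, Complex.norm_exp]
  simp

lemma differentiable_partialSum (lam : ℕ → ℝ) (a : ℕ → ℂ) (N : ℕ) :
    Differentiable ℂ (partialSum lam a N) := by
  unfold partialSum
  fun_prop

lemma partialSum_succ (lam : ℕ → ℝ) (a : ℕ → ℂ) (N : ℕ) (s : ℂ) :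
    partialSum lam a (N + 1) s =
      partialSum lam a N s + a (N + 1) * Complex.exp (-(lam (N + 1) : ℂ) * s) :=
  Finset.sum_Icc_succ_top (by omega) _

lemma ConvergesAt.exists_norm_le {lam : ℕ → ℝ} {a : ℕ → ℂ} {s : ℂ} (h : ConvergesAt lam a s) :
    ∃ K : ℝ, ∀ n, 1 ≤ n → ‖a n‖ ≤ K * Real.exp (lam n * s.re) := by
  obtain ⟨z, hz⟩ := h
  have h0 : Tendsto (fun N => a (N + 1) * Complex.exp (-(lam (N + 1) : ℂ) * s)) atTop (𝓝 0) := by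
    have := (hz.comp (tendsto_add_atTop_nat 1)).sub hz
    simpa [partialSum_succ, Function.comp_def] using this
  obtain ⟨K, hK⟩ := h0.norm.bddAbove_range
  refine ⟨K, fun n hn => ?_⟩
  obtain ⟨m, rfl⟩ := Nat.exists_eq_add_of_le' hn
  have := hK ⟨m, rfl⟩
  simp only [norm_term] at this
  calc ‖a (m + 1)‖ = ‖a (m + 1)‖ * Real.exp (-lam (m + 1) * s.re) *
        Real.exp (lam (m + 1) * s.re) := by
          rw [mul_assoc, ← Real.exp_add]
          simp
    _ ≤ _ := by gcongr

/-- Bohr's condition with a fixed exponent. -/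
lemma BohrCondition.exists_gap {lam : ℕ → ℝ} (h : BohrCondition lam) :
    ∃ L c : ℝ, 0 < L ∧ 0 < c ∧ ∀ n, 1 ≤ n → c * Real.exp (-L * lam n) ≤ lam (n + 1) - lam n := by
  obtain ⟨l, hl, h⟩ := h
  obtain ⟨c, hc, h⟩ := h 1 one_pos
  exact ⟨l + 1, c, by linarith, hc, h⟩

section Gap

variable {lam : ℕ → ℝ} {L c : ℝ}

/-- By `exp x ≥ 1 + x`, the gap condition makes `exp (L λ_n)` grow by at least `L c` at each step.
Hence `exp (-2 L λ_n) = O(n⁻²)`. -/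
lemma mul_le_exp_of_gap (hL : 0 < L)
    (h : ∀ n, 1 ≤ n → c * Real.exp (-L * lam n) ≤ lam (n + 1) - lam n) (n : ℕ) :
    L * c * n ≤ Real.exp (L * lam (n + 1)) := by
  induction n with
  | zero => simpa using (Real.exp_pos _).le
  | succ n ih =>
    have h1 := h (n + 1) (by omega)
    have h2 := Real.add_one_le_exp (L * (lam (n + 1 + 1) - lam (n + 1)))
    have h3 : Real.exp (L * lam (n + 1 + 1)) =
        Real.exp (L * lam (n + 1)) * Real.exp (L * (lam (n + 1 + 1) - lam (n + 1))) := by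
      rw [← Real.exp_add]
      ring_nf
    have h4 : Real.exp (L * lam (n + 1)) * Real.exp (-L * lam (n + 1)) = 1 := by
      rw [← Real.exp_add]
      simp
    have h5 := Real.exp_pos (L * lam (n + 1))
    rw [h3]
    push_cast
    calc L * c * (n + 1) ≤ Real.exp (L * lam (n + 1)) +
          L * (c * (Real.exp (L * lam (n + 1)) * Real.exp (-L * lam (n + 1)))) := by
            rw [h4]
            linarith
      _ = Real.exp (L * lam (n + 1)) * (L * (c * Real.exp (-L * lam (n + 1))) + 1) := by ring
      _ ≤ Real.exp (L * lam (n + 1)) * (L * (lam (n + 1 + 1) - lam (n + 1)) + 1) := by gcongr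
      _ ≤ _ := by gcongr

lemma summable_exp_of_gap (hL : 0 < L) (hc : 0 < c)
    (h : ∀ n, 1 ≤ n → c * Real.exp (-L * lam n) ≤ lam (n + 1) - lam n) :
    Summable fun n => Real.exp (-(2 * L) * lam n) := by
  -- Shifting by two makes the lower bound for `exp (L λ_{n+2})` equal to `L c (n + 1)`, which is
  -- never zero.
  rw [← summable_nat_add_iff 2]
  have hs : Summable fun n : ℕ => (L * c)⁻¹ ^ 2 * (1 / ((n + 1 : ℕ) : ℝ) ^ 2) :=
    ((summable_nat_add_iff 1).2 (Real.summable_one_div_nat_pow.2 one_lt_two)).mul_left _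
  refine Summable.of_nonneg_of_le (fun n => (Real.exp_pos _).le) (fun n => ?_) hs
  have h1 := mul_le_exp_of_gap hL h (n + 1)
  have h2 : Real.exp (-(2 * L) * lam (n + 2)) = (Real.exp (L * lam (n + 1 + 1)))⁻¹ ^ 2 := by
    rw [← Real.exp_neg, ← Real.exp_nat_mul]
    congr 1
    push_cast
    ring
  have h3 : 0 < L * c * ((n + 1 : ℕ) : ℝ) := by positivity
  calc Real.exp (-(2 * L) * lam (n + 2)) ≤ (L * c * ((n + 1 : ℕ) : ℝ))⁻¹ ^ 2 := by
        rw [h2]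
        gcongr
    _ = _ := by
        field_simp

lemma ConvergesAt.exists_summable_bound (hlam : IsFrequency lam) (hL : 0 < L) (hc : 0 < c)
    (h : ∀ n, 1 ≤ n → c * Real.exp (-L * lam n) ≤ lam (n + 1) - lam n) {a : ℕ → ℂ} {s₀ : ℂ}
    (hs₀ : ConvergesAt lam a s₀) :
    ∃ (σ : ℝ) (u : ℕ → ℝ), 0 ≤ σ ∧ Summable u ∧ (∀ n, 0 ≤ u n) ∧ ∀ s ∈ halfPlane σ, ∀ n, 1 ≤ n →
      ‖a n * Complex.exp (-(lam n : ℂ) * s)‖ ≤ u n := by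
  obtain ⟨K, hK⟩ := hs₀.exists_norm_le
  have hK0 : 0 ≤ K := by
    have := (norm_nonneg _).trans (hK 1 le_rfl)
    exact nonneg_of_mul_nonneg_left this (Real.exp_pos _)
  -- The maximum with `0` keeps the half plane inside `[Re > 0]`, where `f` extends the series.
  refine ⟨max (s₀.re + 2 * L) 0, fun n => K * Real.exp (-(2 * L) * lam n), le_max_right _ _,
    (summable_exp_of_gap hL hc h).mul_left K, fun n => by positivity, fun s hs n hn => ?_⟩
  have hs' : s₀.re + 2 * L < s.re := (le_max_left _ _).trans_lt hs
  rw [norm_term]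
  calc ‖a n‖ * Real.exp (-lam n * s.re)
      ≤ K * Real.exp (lam n * s₀.re) * Real.exp (-lam n * s.re) := by
        gcongr
        exact hK n hn
    _ = K * Real.exp (lam n * s₀.re + -lam n * s.re) := by rw [mul_assoc, Real.exp_add]
    _ ≤ K * Real.exp (-(2 * L) * lam n) := by
        gcongr
        nlinarith [hlam.nonneg n hn]

end Gap

lemma convergesAt_of_summable_bound {lam : ℕ → ℝ} {a : ℕ → ℂ} {s : ℂ} {u : ℕ → ℝ}
    (hu : Summable u) (h : ∀ n, 1 ≤ n → ‖a n * Complex.exp (-(lam n : ℂ) * s)‖ ≤ u n) :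
    ConvergesAt lam a s := by
  have hs : Summable fun n => a (n + 1) * Complex.exp (-(lam (n + 1) : ℂ) * s) :=
    Summable.of_norm_bounded ((summable_nat_add_iff 1).2 hu) fun n => h (n + 1) (by omega)
  refine ⟨_, hs.hasSum.tendsto_sum_nat.congr fun N => ?_⟩
  induction N with
  | zero => simp [partialSum]
  | succ N ih => rw [Finset.sum_range_succ, ih, partialSum_succ]

lemma norm_partialSum_le {lam : ℕ → ℝ} {a : ℕ → ℂ} {s : ℂ} {u : ℕ → ℝ}
    (hu : Summable u) (hu0 : ∀ n, 0 ≤ u n)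
    (h : ∀ n, 1 ≤ n → ‖a n * Complex.exp (-(lam n : ℂ) * s)‖ ≤ u n) (N : ℕ) :
    ‖partialSum lam a N s‖ ≤ ∑' n, u n :=
  (norm_sum_le_of_le _ fun n hn => h n (Finset.mem_Icc.1 hn).1).trans
    (hu.sum_le_tsum _ fun n _ => hu0 n)

/-! ### Truncation of the series by the kernel -/

/-- On a half plane of absolute convergence, the convolution with the trapezoid kernel truncates
the series. -/
lemma vertical_integral_trapKernel_eq {lam : ℕ → ℝ} {a : ℕ → ℂ} {f : ℂ → ℂ}
    (hlam : IsFrequency lam) {σ : ℝ} {u : ℕ → ℝ} (hu : Summable u) (hu0 : ∀ n, 0 ≤ u n)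
    (h : ∀ s ∈ halfPlane σ, ∀ n, 1 ≤ n → ‖a n * Complex.exp (-(lam n : ℂ) * s)‖ ≤ u n)
    (hf : ∀ s ∈ halfPlane σ, Tendsto (fun N => partialSum lam a N s) atTop (𝓝 (f s)))
    {N : ℕ} (hN : 1 ≤ N) {B : ℝ} (hMB : lam N ≤ B) (hB : B ≤ lam (N + 1)) {z : ℂ}
    (hz : z ∈ halfPlane σ) :
    ∫ t : ℝ, (trapKernel (lam N) B t : ℂ) * f (z + t * Complex.I) =
      ((kappa * (B - lam N) : ℝ) : ℂ) * partialSum lam a N z := by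
  have hk := integrable_trapKernel (lam N) B
  have hlim : Tendsto (fun m => ∫ t : ℝ, (trapKernel (lam N) B t : ℂ) *
      partialSum lam a m (z + t * Complex.I)) atTop
      (𝓝 (∫ t : ℝ, (trapKernel (lam N) B t : ℂ) * f (z + t * Complex.I))) := by
    refine tendsto_integral_of_dominated_convergence
      (fun t => |trapKernel (lam N) B t| * ∑' n, u n) (fun m => ?_) (hk.abs.mul_const _)
      (fun m => Eventually.of_forall fun t => ?_) (Eventually.of_forall fun t => ?_)
    · exact hk.ofReal.aestronglyMeasurable.mul
        ((differentiable_partialSum lam a m).continuous.comp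
          (by fun_prop)).aestronglyMeasurable
    · rw [norm_mul, Complex.norm_real, Real.norm_eq_abs]
      gcongr
      exact norm_partialSum_le hu hu0 (h _ (add_mul_I_mem_halfPlane hz t)) m
    · exact (hf _ (add_mul_I_mem_halfPlane hz t)).const_mul _
  refine tendsto_nhds_unique hlim (tendsto_const_nhds.congr' ?_)
  -- For `m ≥ N` the integral no longer depends on `m`: the terms with `n > N` have `λ_n ≥ B` and
  -- integrate to zero.
  filter_upwards [eventually_ge_atTop N] with m hm
  have hterm : ∀ t : ℝ, (trapKernel (lam N) B t : ℂ) * partialSum lam a m (z + t * Complex.I) =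
      ∑ n ∈ Finset.Icc 1 m, a n * Complex.exp (-(lam n : ℂ) * z) *
        ((trapKernel (lam N) B t : ℂ) * Complex.exp (-(lam n : ℂ) * (t * Complex.I))) := by
    intro t
    rw [partialSum, Finset.mul_sum]
    refine Finset.sum_congr rfl fun n _ => ?_
    rw [mul_add, Complex.exp_add]
    ring
  simp_rw [hterm]
  rw [integral_finsetSum _ fun n _ => (integrable_trapKernel_mul_exp _ _ _).const_mul _]
  simp_rw [integral_const_mul]
  rw [partialSum, Finset.mul_sum,
    ← Finset.sum_subset (Finset.Icc_subset_Icc_right hm) fun n hn hnN => ?_]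
  · refine Finset.sum_congr rfl fun n hn => ?_
    obtain ⟨hn1, hnN⟩ := Finset.mem_Icc.1 hn
    rw [integral_trapKernel_mul_exp_of_le (hlam.nonneg n hn1)
      (hlam.strictMonoOn.monotoneOn hn1 hN hnN) hMB, mul_comm]
  · have hn' : N + 1 ≤ n := by
      simp only [Finset.mem_Icc] at hn hnN
      omega
    rw [integral_trapKernel_mul_exp_of_ge (hlam.nonneg N hN) hMB
      (hB.trans (hlam.strictMonoOn.monotoneOn (by simp) (by simp; omega) hn')), mul_zero]

lemma norm_partialSum_le_of_bounded {lam : ℕ → ℝ} {a : ℕ → ℂ} {f : ℂ → ℂ}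
    (hlam : IsFrequency lam) (hBC : BohrCondition lam) (ha : ∃ s, ConvergesAt lam a s)
    (hf : IsBoundedExtension lam a f) {A : ℝ} (hA : ∀ s ∈ halfPlane 0, ‖f s‖ ≤ A)
    {N : ℕ} (hN : 1 ≤ N) {B : ℝ} (hMB : lam N < B) (hB : B ≤ lam (N + 1)) {z : ℂ}
    (hz : z ∈ halfPlane 0) :
    ‖partialSum lam a N z‖ ≤ 2 / kappa * (3 + Real.log (B / (B - lam N))) * A := by
  obtain ⟨L, c, hL, hc, hgap⟩ := hBC.exists_gap
  obtain ⟨s₀, hs₀⟩ := ha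
  obtain ⟨σ, u, hσ, hu, hu0, hbound⟩ := hs₀.exists_summable_bound hlam hL hc hgap
  have hk := integrable_trapKernel (lam N) B
  have hd : 0 < B - lam N := sub_pos.2 hMB
  have hκ := kappa_pos
  have hlim : ∀ s ∈ halfPlane σ, Tendsto (fun N => partialSum lam a N s) atTop (𝓝 (f s)) :=
    fun s hs => hf.extends_limit σ
      (fun s hs => convergesAt_of_summable_bound hu (hbound s hs)) s ⟨hs, hσ.trans_lt hs⟩
  have hconn : IsPreconnected (halfPlane 0) := (convex_halfSpace_re_gt 0).isPreconnected
  have hσ1 : ((σ + 1 : ℝ) : ℂ) ∈ halfPlane σ := by simp [halfPlane]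
  have heq : EqOn (fun z => ∫ t : ℝ, (trapKernel (lam N) B t : ℂ) * f (z + t * Complex.I))
      (fun z => ((kappa * (B - lam N) : ℝ) : ℂ) * partialSum lam a N z) (halfPlane 0) := by
    -- Identity theorem: the two sides agree near the point `σ + 1`.
    refine ((differentiableOn_vertical_integral hf.holomorphic hA hk).analyticOnNhd
      (isOpen_halfPlane 0)).eqOn_of_preconnected_of_eventuallyEq
      ((((differentiable_partialSum lam a N).const_mul _).differentiableOn).analyticOnNhd
        (isOpen_halfPlane 0)) hconn (hσ.trans_lt hσ1) ?_
    filter_upwards [(isOpen_halfPlane σ).mem_nhds hσ1] with w hw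
    exact vertical_integral_trapKernel_eq hlam hu hu0 hbound hlim hN hMB.le hB hw
  have h1 := norm_vertical_integral_le hA hk hz
  have h2 := integral_abs_trapKernel_le (hlam.nonneg N hN) hMB
  have hA0 : 0 ≤ A := (norm_nonneg _).trans (hA z hz)
  have h3 := heq hz
  simp only at h3
  rw [h3, norm_mul, Complex.norm_real, Real.norm_of_nonneg (by positivity)] at h1
  have h4 := h1.trans (mul_le_mul_of_nonneg_right h2 hA0)
  rw [mul_assoc, div_mul_eq_mul_div, le_div_iff₀ hκ]
  refine le_of_mul_le_mul_left ?_ hd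
  linarith

/-! ### The choice of `B` and the general theorem -/

lemma exists_log_le {lam : ℕ → ℝ} (hlam : IsFrequency lam) (hBC : BohrCondition lam) :
    ∃ C : ℝ, 0 < C ∧ ∀ N, 2 ≤ N → ∃ B, lam N < B ∧ B ≤ lam (N + 1) ∧
      2 / kappa * (3 + Real.log (B / (B - lam N))) ≤ C * lam N := by
  obtain ⟨L, c, hL, hc, hgap⟩ := hBC.exists_gap
  have hκ := kappa_pos
  have h2 : 0 < lam 2 :=
    (hlam.nonneg 1 le_rfl).trans_lt (hlam.strictMonoOn (by simp) (by simp) one_lt_two)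
  set c' := min 1 c with hc'
  have hc'0 : 0 < c' := lt_min one_pos hc
  have hlog : Real.log c' ≤ 0 := Real.log_nonpos hc'0.le (min_le_left _ _)
  -- Constants are absorbed through `λ_N ≥ λ_2 > 0`; this needs `N ≥ 2`, since `λ_1` may be `0`.
  refine ⟨2 / kappa * ((3 - Real.log c') / lam 2 + (1 + L)), ?_, fun N hN => ?_⟩
  · have : 0 < (3 - Real.log c') / lam 2 := div_pos (by linarith) h2
    positivity
  have hN1 : 1 ≤ N := by omega
  have hM : lam 2 ≤ lam N := hlam.strictMonoOn.monotoneOn (by simp) hN1 hN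
  have hM0 : 0 < lam N := h2.trans_le hM
  have hgapN := hgap N hN1
  -- Capping the gap at `1` gives `log (λ_N + d) ≤ λ_N`, however large the true gap is.
  set d := min 1 (lam (N + 1) - lam N) with hd
  have hdlow : c' * Real.exp (-L * lam N) ≤ d := by
    refine le_min ?_ ((mul_le_mul_of_nonneg_right (min_le_right _ _)
      (Real.exp_pos _).le).trans hgapN)
    refine mul_le_one₀ (min_le_left _ _) (Real.exp_pos _).le (Real.exp_le_one_iff.2 ?_)
    nlinarith
  have hd0 : 0 < d := lt_of_lt_of_le (by positivity) hdlow
  have hd1 : d ≤ 1 := min_le_left _ _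
  have hd2 : d ≤ lam (N + 1) - lam N := min_le_right _ _
  refine ⟨lam N + d, by linarith, by linarith, ?_⟩
  have e1 : Real.log ((lam N + d) / (lam N + d - lam N)) =
      Real.log (lam N + d) - Real.log d := by
    rw [add_sub_cancel_left, Real.log_div (by positivity) hd0.ne']
  have e2 : Real.log (lam N + d) ≤ lam N := by
    have := Real.log_le_sub_one_of_pos (show 0 < lam N + d by positivity)
    linarith
  have e3 : Real.log c' - L * lam N ≤ Real.log d := by
    have := Real.log_le_log (by positivity) hdlow
    rw [Real.log_mul hc'0.ne' (Real.exp_pos _).ne', Real.log_exp] at this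
    linarith
  have e4 : 3 - Real.log c' ≤ (3 - Real.log c') / lam 2 * lam N := by
    rw [div_mul_eq_mul_div, le_div_iff₀ h2]
    gcongr
    linarith
  rw [e1, mul_assoc]
  gcongr
  linarith

theorem exists_supNorm_partialSum_le {lam : ℕ → ℝ} (hlam : IsFrequency lam)
    (hBC : BohrCondition lam) :
    ∃ C : ℝ, 0 < C ∧ ∀ a ∈ DInftyExt lam, ∀ f : ℂ → ℂ, IsBoundedExtension lam a f →
      ∀ N : ℕ, 2 ≤ N →
        supNorm (partialSum lam a N) ≤ ENNReal.ofReal (C * lam N) * supNorm f := by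
  obtain ⟨C, hC, h⟩ := exists_log_le hlam hBC
  refine ⟨C, hC, fun a ha f hf N hN => ?_⟩
  obtain ⟨B, hMB, hB, hle⟩ := h N hN
  have hfin : supNorm f ≠ ∞ := by
    obtain ⟨M, hM⟩ := hf.bounded
    refine ne_top_of_le_ne_top (b := ENNReal.ofReal M) ENNReal.ofReal_ne_top
      (iSup₂_le fun s hs => ?_)
    rw [← ofReal_norm]
    exact ENNReal.ofReal_le_ofReal (hM s hs)
  have hA : ∀ s ∈ halfPlane 0, ‖f s‖ ≤ (supNorm f).toReal := fun s hs => by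
    rw [← toReal_enorm]
    exact ENNReal.toReal_mono hfin (le_iSup₂ (f := fun s (_ : s ∈ halfPlane 0) => ‖f s‖ₑ) s hs)
  have hlamN : 0 ≤ lam N := hlam.nonneg N (by omega)
  refine iSup₂_le fun z hz => ?_
  rw [← ofReal_norm, ← ENNReal.ofReal_toReal hfin,
    ← ENNReal.ofReal_mul (by positivity)]
  refine ENNReal.ofReal_le_ofReal ((norm_partialSum_le_of_bounded hlam hBC ha.1 hf hA
    (by omega) hMB hB hz).trans ?_)
  gcongr

/-! ### Ordinary Dirichlet series -/

lemma isFrequency_log : IsFrequency fun n : ℕ => Real.log n where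
  nonneg n _ := Real.log_natCast_nonneg n
  strictMonoOn m hm n _ hmn :=
    Real.log_lt_log (by exact_mod_cast (show 0 < m from hm)) (by exact_mod_cast hmn)
  tendsto := Real.tendsto_log_atTop.comp tendsto_natCast_atTop_atTop

/-- With `l = 1`: `log (n + 1) - log n ≥ 1 / (n + 1) ≥ 1 / (2 n)`. -/
lemma bohrCondition_log : BohrCondition fun n : ℕ => Real.log n := by
  refine ⟨1, one_pos, fun δ hδ => ⟨1 / 2, by norm_num, fun n hn => ?_⟩⟩
  have hn0 : (1 : ℝ) ≤ n := by exact_mod_cast hn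
  have hlog : 0 ≤ Real.log n := Real.log_nonneg hn0
  have h1 : Real.exp (-(1 + δ) * Real.log n) ≤ (n : ℝ)⁻¹ := by
    rw [← Real.exp_log (show (0 : ℝ) < (n : ℝ)⁻¹ by positivity), Real.log_inv, Real.exp_le_exp]
    nlinarith
  have h2 : 1 / 2 * (n : ℝ)⁻¹ ≤ 1 - (((n + 1 : ℕ) : ℝ) / n)⁻¹ := by
    push_cast
    rw [inv_div, ← sub_nonneg]
    have : 1 - (n : ℝ) / (n + 1) - 1 / 2 * (n : ℝ)⁻¹ = (n - 1) / (2 * n * (n + 1)) := by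
      field_simp
      ring
    rw [this]
    exact div_nonneg (by linarith) (by positivity)
  have h3 := Real.one_sub_inv_le_log_of_pos (show 0 < ((n + 1 : ℕ) : ℝ) / n by positivity)
  rw [Real.log_div (by positivity) (by positivity)] at h3
  linarith

lemma partialSum_log (a : ℕ → ℂ) (N : ℕ) :
    partialSum (fun n : ℕ => Real.log n) a N =
      fun s => ∑ n ∈ Finset.Icc 1 N, a n * (n : ℂ) ^ (-s) := by
  funext s
  refine Finset.sum_congr rfl fun n hn => ?_
  have hn0 : (n : ℂ) ≠ 0 := by
    have := (Finset.mem_Icc.1 hn).1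
    exact_mod_cast (by omega : n ≠ 0)
  rw [Complex.cpow_def_of_ne_zero hn0, ← Complex.natCast_log]
  congr 2
  ring

end GeneralDirichlet

theorem theorem4p4 :
    (∀ lam : ℕ → ℝ, GeneralDirichlet.IsFrequency lam → GeneralDirichlet.BohrCondition lam →
      ∃ C : ℝ, 0 < C ∧
        ∀ a ∈ GeneralDirichlet.DInftyExt lam,
        ∀ f : ℂ → ℂ, GeneralDirichlet.IsBoundedExtension lam a f →
        ∀ N : ℕ, 2 ≤ N →
          GeneralDirichlet.supNorm (GeneralDirichlet.partialSum lam a N) ≤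
            ENNReal.ofReal (C * lam N) * GeneralDirichlet.supNorm f) ∧
    (∃ C : ℝ, 0 < C ∧
        ∀ a ∈ GeneralDirichlet.DInftyExt (fun n : ℕ => Real.log n),
        ∀ f : ℂ → ℂ, GeneralDirichlet.IsBoundedExtension (fun n : ℕ => Real.log n) a f →
        ∀ N : ℕ, 2 ≤ N →
          GeneralDirichlet.supNorm (fun s => ∑ n ∈ Finset.Icc 1 N, a n * (n : ℂ) ^ (-s)) ≤
            ENNReal.ofReal (C * Real.log N) * GeneralDirichlet.supNorm f) := by
  refine ⟨fun lam hlam hBC => GeneralDirichlet.exists_supNorm_partialSum_le hlam hBC, ?_⟩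
  simp_rw [← GeneralDirichlet.partialSum_log]
  exact GeneralDirichlet.exists_supNorm_partialSum_le GeneralDirichlet.isFrequency_log
    GeneralDirichlet.bohrCondition_log
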